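/- For $n\ge 1$ let $\mathcal G_n$ denote the $2$-by-$n$ square grid graph. Let $T_n$ be the number of spanning trees of $\mathcal G_n$, and let $S_n$ be the number of balanced spanning trees of $\mathcal G_n$, that is, spanning trees containing an edge whose removal partitions the $2n$ vertices into two connected components with the same number of vertices. Then: 1. (Odd case) $\displaystyle\lim_{m\to\infty}\frac{S_{2m+1}}{T_{2m+1}}=\frac{3+\sqrt3}{9}\approx 0.53$. 2. (Even case) $\displaystyle\lim_{m\to\infty}\frac{S_{2m}}{T_{2m}}=\frac{1+4\sqrt3}{6\sqrt3}\approx 0.76$. (The decimal approximations are rounded to two digits.) -/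

import Mathlib

namespace BalancedTrees

open SimpleGraph

/-- The `2`-by-`n` square grid graph. -/
abbrev grid (n : ℕ) : SimpleGraph (Fin 2 × Fin n) := pathGraph 2 □ pathGraph n

/-- The spanning trees of a graph `G`: trees on the whole vertex set of `G`
all of whose edges are edges of `G`. -/
def spanningTrees {V : Type*} (G : SimpleGraph V) : Set (SimpleGraph V) :=
  {H | H ≤ G ∧ H.IsTree}

/-- `e` is a balanced cut edge of `H`: it is an edge of `H`, and its removal leaves exactly
two connected components, with equally many vertices. -/
def IsBalancedCutEdge {V : Type*} (H : SimpleGraph V) (e : Sym2 V) : Prop :=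
  e ∈ H.edgeSet ∧ ∃ C D : (H.deleteEdges {e}).ConnectedComponent,
    C ≠ D ∧ (∀ K, K = C ∨ K = D) ∧ C.supp.ncard = D.supp.ncard

/-- The balanced spanning trees of a graph: those with a balanced cut edge. -/
def balancedSpanningTrees {V : Type*} (G : SimpleGraph V) : Set (SimpleGraph V) :=
  {H | H ∈ spanningTrees G ∧ ∃ e, IsBalancedCutEdge H e}

/-- The number of spanning trees of the `2`-by-`n` grid. -/
noncomputable def T (n : ℕ) : ℕ := (spanningTrees (grid n)).ncard

/-- The number of balanced spanning trees of the `2`-by-`n` grid. -/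
noncomputable def S (n : ℕ) : ℕ := (balancedSpanningTrees (grid n)).ncard

end BalancedTrees

/-!
Cutting a spanning tree at one of its edges leaves a spanning tree on each of two complementary
vertex sets `A` and `Aᶜ`, and conversely such a pair of trees together with an edge between `A` and
`Aᶜ` determines the tree. In the `2`-by-`n` grid, connectedness of `A` and `Aᶜ` is so restrictive
that, when the cut edge is the last rung or the cut is balanced, `A` or `Aᶜ` must be a staircase: an
initial segment of lengths `a` and `b` of the two rows. The longer row then has a tail which every
spanning tree contains, so a staircase with `1 ≤ a, b` carries `T (min a b)` spanning trees.
Deleting or cutting the last rung therefore gives `T (n + 2) + T n = 4 * T (n + 1)`, while a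
balanced cut has `a + b = n`, and counting the edges across it expresses `S n` as an explicit sum
of multiples of `T (min a b) ^ 2`. With `T n = ((2 + √3) ^ n - (2 - √3) ^ n) / (2 * √3)` these sums
telescope, which makes `S n` a combination of values of `T` and their squares up to a quadratic
polynomial in `n`.
-/

namespace BalancedTrees

open SimpleGraph Filter Topology

/-! ### Cutting a tree at an edge -/

section Cut

variable {V W : Type*} {G H : SimpleGraph V} {A B : Set V} {u v : V}

theorem reachable_map_of_forall_adj {K : SimpleGraph W} (f : V → W)
    (hf : ∀ x y, H.Adj x y → K.Reachable (f x) (f y)) {x y : V} (h : H.Reachable x y) :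
    K.Reachable (f x) (f y) := by
  obtain ⟨p⟩ := h
  induction p with
  | nil => rfl
  | cons hadj _ ih => exact (hf _ _ hadj).trans ih

theorem mem_of_reachable (hA : ∀ x ∈ A, ∀ y, H.Adj x y → y ∈ A) (h : H.Reachable u v)
    (hu : u ∈ A) : v ∈ A := by
  obtain ⟨p⟩ := h
  by_contra hv
  obtain ⟨d, -, hfst, hsnd⟩ := p.exists_boundary_dart A hu hv
  exact hsnd (hA _ hfst _ d.adj)

/-- The edge from `u ∈ A` to `v ∉ A` is the only edge of `H` between `A` and its complement. -/
structure IsCutDart (H : SimpleGraph V) (A : Set V) (u v : V) : Prop where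
  fst_mem : u ∈ A
  snd_notMem : v ∉ A
  adj_iff : ∀ x ∈ A, ∀ y ∉ A, H.Adj x y ↔ x = u ∧ y = v

namespace IsCutDart

theorem compl (h : IsCutDart H A u v) : IsCutDart H Aᶜ v u where
  fst_mem := h.snd_notMem
  snd_notMem := not_not_intro h.fst_mem
  adj_iff x hx y hy := by
    rw [H.adj_comm, h.adj_iff y (not_not.1 hy) x hx, and_comm]

theorem adj (h : IsCutDart H A u v) : H.Adj u v :=
  (h.adj_iff u h.fst_mem v h.snd_notMem).2 ⟨rfl, rfl⟩

/-- Collapsing the complement of `A` to `u` retracts every subgraph of `H` onto `A`. -/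
theorem reachable_induce {L : SimpleGraph V} (h : IsCutDart H A u v) (hL : L ≤ H) {x y : A}
    (hxy : L.Reachable x y) : (L.induce A).Reachable x y := by
  classical
  let f (w : V) : A := if hw : w ∈ A then ⟨w, hw⟩ else ⟨u, h.fst_mem⟩
  suffices hf : ∀ a b, L.Adj a b → (L.induce A).Reachable (f a) (f b) by
    simpa [f] using reachable_map_of_forall_adj f hf hxy
  intro a b hab
  by_cases ha : a ∈ A <;> by_cases hb : b ∈ A
  · simpa [f, ha, hb] using Adj.reachable (G := L.induce A) (u := ⟨a, ha⟩) (v := ⟨b, hb⟩) hab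
  · simp [f, hb, h.fst_mem, ((h.adj_iff a ha b hb).1 (hL hab)).1]
  · simp [f, ha, h.fst_mem, ((h.adj_iff b hb a ha).1 (hL hab.symm)).1]
  · simp [f, ha, hb]

theorem connected_induce (h : IsCutDart H A u v) (hH : H.Connected) : (H.induce A).Connected :=
  have : Nonempty A := ⟨⟨u, h.fst_mem⟩⟩
  ⟨fun _ _ => h.reachable_induce le_rfl (hH _ _)⟩

theorem isTree_induce (h : IsCutDart H A u v) (hH : H.IsTree) : (H.induce A).IsTree :=
  ⟨h.connected_induce hH.connected, hH.isAcyclic.induce A⟩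

theorem mem_of_reachable_deleteEdges (h : IsCutDart H A u v) {x y : V}
    (hr : (H.deleteEdges {s(u, v)}).Reachable x y) (hx : x ∈ A) : y ∈ A := by
  refine mem_of_reachable (fun a ha b hab => ?_) hr hx
  by_contra hb
  obtain ⟨rfl, rfl⟩ := (h.adj_iff a ha b hb).1 (deleteEdges_le _ hab)
  simp at hab

theorem isBridge (h : IsCutDart H A u v) : H.IsBridge s(u, v) :=
  isBridge_iff.2 fun hr => h.snd_notMem (h.mem_of_reachable_deleteEdges hr h.fst_mem)

theorem isBridge_of_isAcyclic_induce (h : IsCutDart H A u v) (hA : (H.induce A).IsAcyclic)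
    {x y : V} (hx : x ∈ A) (hy : y ∈ A) (hxy : H.Adj x y) : H.IsBridge s(x, y) := by
  have hbridge := isAcyclic_iff_forall_adj_isBridge.1 hA (v := ⟨x, hx⟩) (w := ⟨y, hy⟩) hxy
  rw [isBridge_iff] at hbridge ⊢
  refine fun hr => hbridge ?_
  refine (h.reachable_induce (x := ⟨x, hx⟩) (y := ⟨y, hy⟩) (deleteEdges_le _) hr).mono ?_
  intro a b hab
  simpa [deleteEdges_adj, Subtype.ext_iff] using hab

theorem isTree (h : IsCutDart H A u v) (hA : (H.induce A).IsTree) (hB : (H.induce Aᶜ).IsTree) :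
    H.IsTree := by
  refine ⟨connected_iff_exists_forall_reachable _ |>.2 ⟨u, fun w => ?_⟩,
    isAcyclic_iff_forall_adj_isBridge.2 fun x y hxy => ?_⟩
  · by_cases hw : w ∈ A
    · exact (hA.connected ⟨u, h.fst_mem⟩ ⟨w, hw⟩).map (Embedding.induce A).toHom
    · exact h.adj.reachable.trans
        ((hB.connected ⟨v, h.snd_notMem⟩ ⟨w, hw⟩).map (Embedding.induce Aᶜ).toHom)
  · by_cases hx : x ∈ A <;> by_cases hy : y ∈ A
    · exact h.isBridge_of_isAcyclic_induce hA.isAcyclic hx hy hxy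
    · obtain ⟨rfl, rfl⟩ := (h.adj_iff x hx y hy).1 hxy
      exact h.isBridge
    · obtain ⟨rfl, rfl⟩ := (h.adj_iff y hy x hx).1 hxy.symm
      exact Sym2.eq_swap ▸ h.isBridge
    · exact h.compl.isBridge_of_isAcyclic_induce hB.isAcyclic hx hy hxy

theorem subset_or_subset_compl (h : IsCutDart H A u v) (hB : (H.induce B).Preconnected)
    (huv : ¬ (u ∈ B ∧ v ∈ B)) : B ⊆ A ∨ B ⊆ Aᶜ := by
  by_contra! hBA
  obtain ⟨⟨y, hyB, hyA⟩, ⟨x, hxB, hxA⟩⟩ := hBA.imp Set.not_subset.1 Set.not_subset.1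
  refine hyA (mem_of_reachable (A := Subtype.val ⁻¹' A) (fun a ha b hab => ?_)
    (hB ⟨x, hxB⟩ ⟨y, hyB⟩) (not_not.1 hxA))
  by_contra hb
  obtain ⟨rfl, rfl⟩ := (h.adj_iff a ha b hb).1 hab
  exact huv ⟨a.2, b.2⟩

theorem eq_of_ncard_eq_ncard_compl [Finite V] {u' v' w : V} (hH : H.Connected)
    (hA : IsCutDart H A u v) (hB : IsCutDart H B u' v') (hwA : w ∈ A) (hwB : w ∈ B)
    (hcardA : A.ncard = Aᶜ.ncard) (hcardB : B.ncard = Bᶜ.ncard) : A = B := by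
  have hsumA := Set.ncard_add_ncard_compl A
  have hsumB := Set.ncard_add_ncard_compl B
  by_cases hAB : u ∈ B ∧ v ∈ B
  · have hAB' : ¬ (u ∈ Bᶜ ∧ v ∈ Bᶜ) := fun h => h.1 hAB.1
    rcases hA.subset_or_subset_compl (hB.compl.connected_induce hH).preconnected hAB' with h | h
    · exact absurd hwA (Set.eq_of_subset_of_ncard_le h (by omega) ▸ not_not_intro hwB)
    · exact Set.eq_of_subset_of_ncard_le (Set.compl_subset_compl.1 h) (by omega)
  · rcases hA.subset_or_subset_compl (hB.connected_induce hH).preconnected hAB with h | h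
    · exact (Set.eq_of_subset_of_ncard_le h (by omega)).symm
    · exact absurd hwA (h hwB)

end IsCutDart

/-- The vertices on the side of `u` once the edge `s(u, v)` has been removed from `H`. -/
def side (H : SimpleGraph V) (u v : V) : Set V :=
  ((H.deleteEdges {s(u, v)}).connectedComponentMk u).supp

theorem mem_side {w : V} : w ∈ side H u v ↔ (H.deleteEdges {s(u, v)}).Reachable u w := by
  rw [side, ConnectedComponent.mem_supp_iff, ConnectedComponent.eq, reachable_comm]

theorem compl_side (hH : H.IsTree) (huv : H.Adj u v) : (side H u v)ᶜ = side H v u := by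
  have hbridge := isBridge_iff.1 (isAcyclic_iff_forall_adj_isBridge.1 hH.isAcyclic huv)
  ext w
  rw [Set.mem_compl_iff, mem_side, mem_side, Sym2.eq_swap (a := v)]
  refine ⟨fun hw => ?_, fun hv hu => hbridge (hu.trans hv.symm)⟩
  refine (mem_of_reachable (A := {w | (H.deleteEdges {s(u, v)}).Reachable u w ∨
    (H.deleteEdges {s(u, v)}).Reachable v w}) (fun x hx y hxy => ?_)
    (hH.connected u w) (.inl .rfl)).resolve_left hw
  by_cases he : s(x, y) = s(u, v)
  · rcases Sym2.eq_iff.1 he with ⟨-, rfl⟩ | ⟨-, rfl⟩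
    · exact .inr .rfl
    · exact .inl .rfl
  · have hxy' : (H.deleteEdges {s(u, v)}).Adj x y := by simp [hxy, he]
    exact hx.imp (·.trans hxy'.reachable) (·.trans hxy'.reachable)

theorem isCutDart_side (hH : H.IsTree) (huv : H.Adj u v) : IsCutDart H (side H u v) u v := by
  have hv : v ∉ side H u v := by
    rw [mem_side, ← isBridge_iff]
    exact isAcyclic_iff_forall_adj_isBridge.1 hH.isAcyclic huv
  refine ⟨mem_side.2 .rfl, hv, fun x hx y hy => ⟨fun hxy => ?_, ?_⟩⟩
  · have he : s(x, y) = s(u, v) := by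
      by_contra he
      have hxy' : (H.deleteEdges {s(u, v)}).Adj x y := by simp [hxy, he]
      exact hy (mem_side.2 ((mem_side.1 hx).trans hxy'.reachable))
    rcases Sym2.eq_iff.1 he with h | ⟨rfl, rfl⟩
    · exact h
    · exact absurd hx hv
  · rintro ⟨rfl, rfl⟩
    exact huv

theorem IsCutDart.eq_side (h : IsCutDart H A u v) (hH : H.IsTree) : A = side H u v := by
  refine Set.Subset.antisymm ?_ fun w hw =>
    h.mem_of_reachable_deleteEdges (mem_side.1 hw) h.fst_mem
  rw [← Set.compl_subset_compl, compl_side hH h.adj]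
  exact fun w hw => h.compl.mem_of_reachable_deleteEdges (mem_side.1 hw) h.snd_notMem

theorem isBalancedCutEdge_iff (hH : H.IsTree) (huv : H.Adj u v) :
    IsBalancedCutEdge H s(u, v) ↔ (side H u v).ncard = (side H u v)ᶜ.ncard := by
  have hside : (side H v u) = ((H.deleteEdges {s(u, v)}).connectedComponentMk v).supp := by
    rw [side, Sym2.eq_swap]
  have hne : (H.deleteEdges {s(u, v)}).connectedComponentMk u ≠
      (H.deleteEdges {s(u, v)}).connectedComponentMk v := fun h =>
    (isCutDart_side hH huv).snd_notMem (mem_side.2 (ConnectedComponent.eq.1 h))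
  rw [compl_side hH huv, hside, side]
  refine ⟨fun ⟨_, C, D, _, hCD, hcard⟩ => ?_, fun h => ⟨huv, _, _, hne, fun K => ?_, h⟩⟩
  · rcases hCD (connectedComponentMk _ u) with hu | hu <;>
    rcases hCD (connectedComponentMk _ v) with hv | hv <;> grind
  · induction K using ConnectedComponent.ind with | h w =>
    by_cases hw : w ∈ side H u v
    · exact .inl (ConnectedComponent.mem_supp_iff _ _ |>.1 hw)
    · rw [← Set.mem_compl_iff, compl_side hH huv, hside] at hw
      exact .inr (ConnectedComponent.mem_supp_iff _ _ |>.1 hw)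

theorem mem_balancedSpanningTrees_iff (w : V) : H ∈ balancedSpanningTrees G ↔
    H ∈ spanningTrees G ∧ ∃ A u v, w ∈ A ∧ A.ncard = Aᶜ.ncard ∧ IsCutDart H A u v := by
  refine and_congr_right fun ⟨_, hH⟩ => ⟨fun ⟨e, he⟩ => ?_, fun ⟨A, u, v, _, hcard, h⟩ => ?_⟩
  · induction e using Sym2.ind with | h u v =>
    have huv : H.Adj u v := he.1
    have hcut := isCutDart_side hH huv
    rw [isBalancedCutEdge_iff hH huv] at he
    by_cases hw : w ∈ side H u v
    · exact ⟨_, _, _, hw, he, hcut⟩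
    · exact ⟨_, _, _, hw, by rw [compl_compl, he], hcut.compl⟩
  · exact ⟨_, (isBalancedCutEdge_iff hH h.adj).2 (h.eq_side hH ▸ hcard)⟩

/-- The number of spanning trees of the subgraph of `G` induced on `A`. -/
noncomputable def treeCount (G : SimpleGraph V) (A : Set V) : ℕ :=
  (spanningTrees (G.induce A)).ncard

/-- The number of pairs of spanning trees, one of the subgraph of `G` induced on `A` and one of the
subgraph induced on the complement of `A`. -/
noncomputable def splitCount (G : SimpleGraph V) (A : Set V) : ℕ :=
  treeCount G A * treeCount G Aᶜ

theorem splitCount_compl : splitCount G Aᶜ = splitCount G A := by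
  rw [splitCount, splitCount, compl_compl, mul_comm]

theorem injOn_induce : Set.InjOn
    (fun H : SimpleGraph V => (H.induce A, H.induce Aᶜ)) {H | IsCutDart H A u v} := by
  intro H hH K hK hHK
  obtain ⟨hA, hB⟩ := Prod.ext_iff.1 hHK
  ext x y
  by_cases hx : x ∈ A <;> by_cases hy : y ∈ A
  · exact iff_of_eq (congrArg (fun L : SimpleGraph A => L.Adj ⟨x, hx⟩ ⟨y, hy⟩) hA)
  · rw [hH.adj_iff x hx y hy, hK.adj_iff x hx y hy]
  · rw [H.adj_comm, K.adj_comm, hH.adj_iff y hy x hx, hK.adj_iff y hy x hx]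
  · exact iff_of_eq (congrArg (fun L : SimpleGraph ↥Aᶜ => L.Adj ⟨x, hx⟩ ⟨y, hy⟩) hB)

theorem exists_isCutDart_induce_eq (hu : u ∈ A) (hv : v ∉ A) (K : SimpleGraph A)
    (L : SimpleGraph ↥Aᶜ) : ∃ H, IsCutDart H A u v ∧ H.induce A = K ∧ H.induce Aᶜ = L := by
  refine ⟨K.spanningCoe ⊔ L.spanningCoe ⊔ edge u v, ⟨hu, hv, fun x hx y hy => ?_⟩, ?_, ?_⟩
  · simp only [sup_adj, map_adj, edge_adj, Function.Embedding.subtype_apply]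
    grind
  · ext x y
    simp only [comap_adj, sup_adj, map_adj, edge_adj, Function.Embedding.subtype_apply]
    grind
  · ext x y
    simp only [comap_adj, sup_adj, map_adj, edge_adj, Function.Embedding.subtype_apply]
    grind

theorem ncard_isCutDart (hu : u ∈ A) (hv : v ∉ A) (huv : G.Adj u v) :
    {H ∈ spanningTrees G | IsCutDart H A u v}.ncard = splitCount G A := by
  suffices h : Set.BijOn (fun H => (H.induce A, H.induce Aᶜ))
      {H ∈ spanningTrees G | IsCutDart H A u v}
      (spanningTrees (G.induce A) ×ˢ spanningTrees (G.induce Aᶜ)) by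
    rw [splitCount, treeCount, treeCount, ← Set.ncard_prod, ← h.image_eq, h.injOn.ncard_image]
  refine ⟨?_, injOn_induce.mono fun H hH => hH.2, ?_⟩
  · exact fun H ⟨⟨hHG, hH⟩, h⟩ => ⟨⟨comap_monotone _ hHG, h.isTree_induce hH⟩,
      comap_monotone _ hHG, h.compl.isTree_induce hH⟩
  · rintro ⟨K, L⟩ ⟨⟨hKG, hK⟩, hLG, hL⟩
    obtain ⟨H, h, rfl, rfl⟩ := exists_isCutDart_induce_eq hu hv K L
    refine ⟨H, ⟨⟨fun x y hxy => ?_, h.isTree hK hL⟩, h⟩, rfl⟩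
    by_cases hx : x ∈ A <;> by_cases hy : y ∈ A
    · exact @hKG ⟨x, hx⟩ ⟨y, hy⟩ hxy
    · obtain ⟨rfl, rfl⟩ := (h.adj_iff x hx y hy).1 hxy
      exact huv
    · obtain ⟨rfl, rfl⟩ := (h.adj_iff y hy x hx).1 hxy.symm
      exact huv.symm
    · exact @hLG ⟨x, hx⟩ ⟨y, hy⟩ hxy

/-- The darts of `G` leaving `A`. -/
def boundary (G : SimpleGraph V) (A : Set V) : Set (V × V) :=
  {d | d.1 ∈ A ∧ d.2 ∉ A ∧ G.Adj d.1 d.2}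

theorem IsCutDart.dart_eq {d e : V × V} (hd : IsCutDart H A d.1 d.2)
    (he : IsCutDart H A e.1 e.2) : d = e :=
  Prod.ext_iff.2 ((he.adj_iff _ hd.fst_mem _ hd.snd_notMem).1 hd.adj)

theorem ncard_exists_isCutDart [Finite V] (G : SimpleGraph V) (A : Set V) :
    {H ∈ spanningTrees G | ∃ u v, IsCutDart H A u v}.ncard =
      (boundary G A).ncard * splitCount G A := by
  have hunion : {H ∈ spanningTrees G | ∃ u v, IsCutDart H A u v} =
      ⋃ d ∈ boundary G A, {H ∈ spanningTrees G | IsCutDart H A d.1 d.2} := by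
    ext H
    simp only [boundary, Set.mem_iUnion₂, Set.mem_ofPred_eq, exists_prop, Prod.exists]
    exact ⟨fun ⟨hH, u, v, h⟩ => ⟨u, v, ⟨h.fst_mem, h.snd_notMem, hH.1 h.adj⟩, hH, h⟩,
      fun ⟨u, v, _, hH, h⟩ => ⟨hH, u, v, h⟩⟩
  have hdisj : (boundary G A).PairwiseDisjoint
      fun d => {H ∈ spanningTrees G | IsCutDart H A d.1 d.2} := fun d _ e _ hde =>
    Set.disjoint_left.2 fun H hd he => hde (hd.2.dart_eq he.2)
  rw [hunion, (Set.toFinite _).ncard_biUnion (fun _ _ => Set.toFinite _) hdisj,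
    finsum_mem_congr rfl fun d hd => ncard_isCutDart hd.1 hd.2.1 hd.2.2,
    ← finsum_one (s := boundary G A), finsum_mem_mul]
  simp only [one_mul]

theorem ncard_spanningTrees_adj [Finite V] (huv : G.Adj u v) :
    {H ∈ spanningTrees G | H.Adj u v}.ncard =
      ∑ᶠ A ∈ {A | u ∈ A ∧ v ∉ A}, splitCount G A := by
  have hunion : {H ∈ spanningTrees G | H.Adj u v} =
      ⋃ A ∈ {A | u ∈ A ∧ v ∉ A}, {H ∈ spanningTrees G | IsCutDart H A u v} := by
    ext H
    simp only [Set.mem_iUnion₂, Set.mem_ofPred_eq, exists_prop]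
    exact ⟨fun ⟨hH, h⟩ => have hs := isCutDart_side hH.2 h
      ⟨_, ⟨hs.fst_mem, hs.snd_notMem⟩, hH, hs⟩, fun ⟨_, _, hH, h⟩ => ⟨hH, h.adj⟩⟩
  have hdisj : {A | u ∈ A ∧ v ∉ A}.PairwiseDisjoint
      fun A => {H ∈ spanningTrees G | IsCutDart H A u v} := fun A _ B _ hAB =>
    Set.disjoint_left.2 fun H hA hB =>
      hAB ((hA.2.eq_side hA.1.2).trans (hB.2.eq_side hB.1.2).symm)
  rw [hunion, (Set.toFinite _).ncard_biUnion (fun _ _ => Set.toFinite _) hdisj]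
  exact finsum_mem_congr rfl fun A hA => ncard_isCutDart hA.1 hA.2 huv

theorem le_deleteEdges_singleton : H ≤ G.deleteEdges {s(u, v)} ↔ H ≤ G ∧ ¬ H.Adj u v := by
  rw [deleteEdges, le_sdiff, disjoint_fromEdgeSet, Set.disjoint_singleton_right, mem_edgeSet]

theorem ncard_spanningTrees_eq_deleteEdges_add [Finite V] (huv : G.Adj u v) :
    (spanningTrees G).ncard = (spanningTrees (G.deleteEdges {s(u, v)})).ncard +
      ∑ᶠ A ∈ {A | u ∈ A ∧ v ∉ A}, splitCount G A := by
  have hdelete : spanningTrees (G.deleteEdges {s(u, v)}) = {H ∈ spanningTrees G | ¬ H.Adj u v} := by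
    ext H
    simp only [spanningTrees, Set.mem_ofPred_eq, le_deleteEdges_singleton]
    tauto
  have hdisj : Disjoint {H ∈ spanningTrees G | ¬ H.Adj u v} {H ∈ spanningTrees G | H.Adj u v} :=
    Set.disjoint_left.2 fun _ h h' => h.2 h'.2
  rw [hdelete, ← ncard_spanningTrees_adj huv, ← Set.ncard_union_eq hdisj (Set.toFinite _)
    (Set.toFinite _)]
  congr 1
  ext H
  simp only [Set.mem_union, Set.mem_ofPred_eq]
  tauto

theorem ncard_balancedSpanningTrees [Finite V] (G : SimpleGraph V) (w : V) :
    (balancedSpanningTrees G).ncard = ∑ᶠ A ∈ {A | w ∈ A ∧ A.ncard = Aᶜ.ncard},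
      (boundary G A).ncard * splitCount G A := by
  have hunion : balancedSpanningTrees G = ⋃ A ∈ {A | w ∈ A ∧ A.ncard = Aᶜ.ncard},
      {H ∈ spanningTrees G | ∃ u v, IsCutDart H A u v} := by
    ext H
    rw [mem_balancedSpanningTrees_iff w]
    simp only [Set.mem_iUnion₂, Set.mem_ofPred_eq, exists_prop]
    grind
  have hdisj : {A | w ∈ A ∧ A.ncard = Aᶜ.ncard}.PairwiseDisjoint
      fun A => {H ∈ spanningTrees G | ∃ u v, IsCutDart H A u v} := fun A hA B hB hAB =>
    Set.disjoint_left.2 fun H ⟨hH, _, _, hHA⟩ ⟨_, _, _, hHB⟩ => hAB <|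
      hHA.eq_of_ncard_eq_ncard_compl hH.2.connected hHB hA.1 hB.1 hA.2 hB.2
  rw [hunion, (Set.toFinite _).ncard_biUnion (fun _ _ => Set.toFinite _) hdisj]
  exact finsum_mem_congr rfl fun A _ => ncard_exists_isCutDart G A

theorem ncard_spanningTrees_congr {K : SimpleGraph W} (e : G ≃g K) :
    (spanningTrees G).ncard = (spanningTrees K).ncard := by
  refine Set.ncard_congr' (e.toEquiv.simpleGraph.subtypeEquiv fun H => and_congr ?_ ?_)
  · have hadj : ∀ x y, (e.toEquiv.simpleGraph H).Adj (e x) (e y) ↔ H.Adj x y := fun _ _ =>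
      (Iso.comap e.toEquiv.symm H).symm.map_adj_iff
    simp only [le_iff_adj, e.surjective.forall₂, hadj, e.map_adj_iff]
  · exact (Iso.comap e.toEquiv.symm H).isTree_iff.symm

theorem treeCount_image {K : SimpleGraph W} (f : G ↪g K) (A : Set V) :
    treeCount K (f '' A) = treeCount G A :=
  ncard_spanningTrees_congr
    (Iso.symm
      { toEquiv := Equiv.Set.image f A f.injective
        map_rel_iff' := f.map_adj_iff })

theorem treeCount_univ (G : SimpleGraph V) :
    treeCount G Set.univ = (spanningTrees G).ncard :=
  ncard_spanningTrees_congr (induceUnivIso G)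

theorem treeCount_singleton (G : SimpleGraph V) (v : V) : treeCount G {v} = 1 := by
  rw [treeCount, Set.ncard_eq_one]
  exact ⟨⊥, Set.eq_singleton_iff_unique_mem.2
    ⟨⟨bot_le, .of_subsingleton⟩, fun H _ => Subsingleton.elim _ _⟩⟩

theorem ncard_spanningTrees_of_pendant (huv : G.Adj u v) (h : ∀ x, G.Adj x v → x = u) :
    (spanningTrees G).ncard = treeCount G {v}ᶜ := by
  have hcut : ∀ H ∈ spanningTrees G, IsCutDart H {v}ᶜ u v := by
    intro H hH
    refine ⟨huv.ne, not_not_intro rfl, fun x hx y hy => ?_⟩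
    obtain rfl : y = v := not_not.1 hy
    have : Nontrivial V := huv.nontrivial
    obtain ⟨w, hw⟩ := hH.2.connected.preconnected.exists_adj_of_nontrivial y
    exact ⟨fun hxy => ⟨h x (hH.1 hxy), rfl⟩,
      fun ⟨hxu, _⟩ => by rwa [hxu, ← h w (hH.1 hw.symm), H.adj_comm]⟩
  rw [← Set.sep_eq_self_iff_mem_true.2 hcut, ncard_isCutDart huv.ne (not_not_intro rfl) huv,
    splitCount, compl_compl, treeCount_singleton, mul_one]

theorem treeCount_insert (hu : u ∈ A) (hv : v ∉ A) (huv : G.Adj u v)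
    (h : ∀ x ∈ A, G.Adj x v → x = u) : treeCount G (insert v A) = treeCount G A := by
  have himage : (Embedding.induce (G := G) (insert v A)) '' {⟨v, Set.mem_insert v A⟩}ᶜ = A := by
    ext x
    simp only [Embedding.comap_apply, Function.Embedding.subtype_apply, Set.mem_image,
      Set.mem_compl_iff, Set.mem_singleton_iff, Subtype.exists, Subtype.mk.injEq,
      Set.mem_insert_iff, exists_and_left, exists_prop, exists_eq_right_right]
    grind
  rw [treeCount, ncard_spanningTrees_of_pendant (u := ⟨u, Set.mem_insert_of_mem v hu⟩)
    (v := ⟨v, Set.mem_insert v A⟩) huv, ← treeCount_image (Embedding.induce _), himage]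
  rintro ⟨x, rfl | hx⟩ hxv
  · exact absurd hxv (G.irrefl)
  · exact Subtype.ext (h x hx hxv)

theorem treeCount_preimage {K : SimpleGraph W} (e : G ≃g K) (A : Set W) :
    treeCount G (e ⁻¹' A) = treeCount K A := by
  rw [← treeCount_image e.toEmbedding]
  exact congrArg _ (Set.image_preimage_eq A e.surjective)

theorem splitCount_preimage {K : SimpleGraph W} (e : G ≃g K) (A : Set W) :
    splitCount G (e ⁻¹' A) = splitCount K A := by
  rw [splitCount, ← Set.preimage_compl, treeCount_preimage, treeCount_preimage, splitCount]

theorem ncard_boundary_preimage {K : SimpleGraph W} (e : G ≃g K) (A : Set W) :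
    (boundary G (e ⁻¹' A)).ncard = (boundary K A).ncard := by
  have hpreimage : boundary G (e ⁻¹' A) = e.toEquiv.prodCongr e.toEquiv ⁻¹' boundary K A := by
    ext d
    exact and_congr_right' (and_congr_right' e.map_adj_iff.symm)
  rw [hpreimage, Set.ncard_preimage_of_injective_subset_range (Equiv.injective _)
    ((Equiv.range_eq_univ _) ▸ Set.subset_univ _)]

theorem treeCount_deleteEdges_singleton (h : ¬ (u ∈ A ∧ v ∈ A)) :
    treeCount (G.deleteEdges {s(u, v)}) A = treeCount G A := by
  have hinduce : (G.deleteEdges {s(u, v)}).induce A = G.induce A := by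
    ext x y
    simp only [comap_adj, Function.Embedding.subtype_apply, deleteEdges_adj,
      Set.mem_singleton_iff, Sym2.eq_iff]
    grind
  rw [treeCount, hinduce, treeCount]

theorem preconnected_of_treeCount_ne_zero (h : treeCount G A ≠ 0) : (G.induce A).Preconnected := by
  obtain ⟨H, hH, htree⟩ := Set.nonempty_of_ncard_ne_zero h
  exact (htree.connected.mono hH).preconnected

theorem preconnected_of_splitCount_ne_zero (h : splitCount G A ≠ 0) :
    (G.induce A).Preconnected ∧ (G.induce Aᶜ).Preconnected :=
  (mul_ne_zero_iff.1 h).imp preconnected_of_treeCount_ne_zero preconnected_of_treeCount_ne_zero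

end Cut

/-! ### Staircase regions of the grid -/

section Grid

variable {m n a b : ℕ}

theorem grid_adj {p q : Fin 2 × Fin n} : (grid n).Adj p q ↔
    p.1 ≠ q.1 ∧ p.2 = q.2 ∨ p.1 = q.1 ∧ ((p.2 : ℕ) + 1 = q.2 ∨ (q.2 : ℕ) + 1 = p.2) := by
  rw [grid, boxProd_adj, pathGraph_adj, pathGraph_adj]
  grind

/-- The part of the `2`-by-`n` grid made of the first `a` vertices of row `0` and the first `b`
vertices of row `1`. -/
def region (n a b : ℕ) : Set (Fin 2 × Fin n) :=
  {p | (p.2 : ℕ) < if p.1 = 0 then a else b}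

theorem mem_region {p : Fin 2 × Fin n} :
    p ∈ region n a b ↔ (p.2 : ℕ) < if p.1 = 0 then a else b :=
  Iff.rfl

/-- The reflection of the grid exchanging its two rows. -/
def rowFlip (n : ℕ) : grid n ≃g grid n where
  toEquiv := Fin.revPerm.prodCongr (.refl _)
  map_rel_iff' := by
    intro p q
    rw [grid_adj, grid_adj]
    simp only [Equiv.prodCongr_apply, Prod.map_fst, Prod.map_snd, Fin.revPerm_apply,
      Equiv.refl_apply, Fin.rev_inj, ne_eq]

/-- The reflection of the grid reversing the order of its columns. -/
def columnFlip (n : ℕ) : grid n ≃g grid n where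
  toEquiv := (Equiv.refl _).prodCongr Fin.revPerm
  map_rel_iff' := by
    intro p q
    rw [grid_adj, grid_adj]
    simp only [Equiv.prodCongr_apply, Prod.map_fst, Prod.map_snd, Fin.revPerm_apply,
      Equiv.refl_apply, Fin.rev_inj, ne_eq, Fin.val_rev]
    grind

/-- The inclusion of the first `m` columns of a grid. -/
def columnCastLE (h : m ≤ n) : grid m ↪g grid n where
  toEmbedding := (Function.Embedding.refl _).prodMap (Fin.castLEEmb h)
  map_rel_iff' := by
    intro p q
    rw [grid_adj, grid_adj]
    simp only [Function.Embedding.coe_prodMap, Prod.map_fst, Prod.map_snd, Fin.castLEEmb_apply,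
      Function.Embedding.refl_apply, Fin.castLE_inj, ne_eq, Fin.val_castLE]

theorem rowFlip_preimage_region : rowFlip n ⁻¹' region n a b = region n b a := by
  ext ⟨r, i⟩
  simp only [rowFlip, Set.mem_preimage, mem_region, RelIso.coe_fn_mk, Equiv.prodCongr_apply,
    Prod.map_fst, Prod.map_snd, Fin.revPerm_apply, Equiv.refl_apply]
  fin_cases r <;> rfl

theorem columnFlip_preimage_region :
    columnFlip n ⁻¹' region n (n - a) (n - b) = (region n a b)ᶜ := by
  ext ⟨r, i⟩
  simp only [columnFlip, Set.mem_preimage, mem_region, RelIso.coe_fn_mk, Equiv.prodCongr_apply,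
    Prod.map_fst, Prod.map_snd, Fin.revPerm_apply, Equiv.refl_apply, Fin.val_rev,
    Set.mem_compl_iff]
  grind

theorem image_columnCastLE_univ (h : m ≤ n) :
    columnCastLE h '' Set.univ = region n m m := by
  ext ⟨r, i⟩
  rw [Set.image_univ, Set.mem_range, mem_region, ite_self]
  refine ⟨?_, fun hi => ⟨(r, ⟨i, hi⟩), rfl⟩⟩
  rintro ⟨p, hp⟩
  exact hp ▸ p.2.2

theorem treeCount_region_comm : treeCount (grid n) (region n a b) =
    treeCount (grid n) (region n b a) := by
  rw [← rowFlip_preimage_region, treeCount_preimage]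

theorem treeCount_compl_region : treeCount (grid n) (region n a b)ᶜ =
    treeCount (grid n) (region n (n - a) (n - b)) := by
  rw [← columnFlip_preimage_region, treeCount_preimage]

theorem splitCount_region_comm : splitCount (grid n) (region n a b) =
    splitCount (grid n) (region n b a) := by
  rw [← rowFlip_preimage_region, splitCount_preimage]

theorem treeCount_region_self (h : m ≤ n) : treeCount (grid n) (region n m m) = T m := by
  rw [← image_columnCastLE_univ h, treeCount_image, treeCount_univ, T]

theorem region_succ_right (hbn : b < n) :
    region n a (b + 1) = insert (1, ⟨b, hbn⟩) (region n a b) := by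
  ext ⟨r, i⟩
  simp only [Set.mem_insert_iff, mem_region, Prod.mk.injEq, Fin.ext_iff]
  grind

theorem treeCount_region_succ (hb : 1 ≤ b) (hab : a ≤ b) (hbn : b < n) :
    treeCount (grid n) (region n a (b + 1)) = treeCount (grid n) (region n a b) := by
  rw [region_succ_right hbn]
  refine treeCount_insert (u := (1, ⟨b - 1, by omega⟩)) ?_ ?_ ?_ fun ⟨r, i⟩ hi hadj => ?_
  · grind [mem_region]
  · grind [mem_region]
  · rw [grid_adj]
    grind
  · rw [grid_adj] at hadj
    grind [mem_region]

theorem treeCount_region_of_le (ha : 1 ≤ a) (hab : a ≤ b) (hbn : b ≤ n) :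
    treeCount (grid n) (region n a b) = T a := by
  induction b, hab using Nat.le_induction with
  | base => exact treeCount_region_self hbn
  | succ b hab ih => rw [treeCount_region_succ (ha.trans hab) hab hbn, ih (by omega)]

theorem treeCount_region_zero (hb : 1 ≤ b) (hbn : b ≤ n) :
    treeCount (grid n) (region n 0 b) = 1 := by
  induction b, hb using Nat.le_induction with
  | base =>
    have hsingleton : region n 0 1 = {(1, ⟨0, hbn⟩)} := by
      ext ⟨r, i⟩
      simp only [Set.mem_singleton_iff, mem_region, Prod.mk.injEq, Fin.ext_iff]
      grind
    rw [hsingleton, treeCount_singleton]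
  | succ b hb ih => rw [treeCount_region_succ hb (by omega) hbn, ih (by omega)]

theorem exists_mem_mem_of_covBy {A : Set (Fin 2 × Fin n)}
    (hA : ((grid n).induce A).Preconnected) {p q : Fin 2 × Fin n} (hp : p ∈ A) (hq : q ∈ A)
    {c d : Fin n} (hcd : c ⋖ d) (hpc : p.2 ≤ c) (hdq : d ≤ q.2) :
    ∃ r, (r, c) ∈ A ∧ (r, d) ∈ A := by
  obtain ⟨walk⟩ := hA ⟨p, hp⟩ ⟨q, hq⟩
  obtain ⟨⟨⟨x, y⟩, hadj⟩, -, hx, hy⟩ := walk.exists_boundary_dart {x | x.1.2 ≤ c} hpc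
    (hcd.lt.trans_le hdq).not_ge
  rw [Fin.covBy_iff, Nat.covBy_iff_add_one_eq] at hcd
  have hxy := grid_adj.1 (comap_adj.1 hadj)
  simp only [Function.Embedding.subtype_apply] at hxy
  simp only [Set.mem_ofPred_eq, not_le] at hx hy
  have hxc : x.1.2 = c := by grind
  have hyd : y.1.2 = d := by grind
  refine ⟨x.1.1, hxc ▸ x.2, ?_⟩
  have hrow : x.1.1 = y.1.1 := by grind
  exact hrow ▸ hyd ▸ y.2

/-- Where a row passes from `Aᶜ` to `A`, the other row must already belong to `A`, which leaves
no room for `Aᶜ` to get across. -/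
theorem le_of_notMem_of_covBy {A : Set (Fin 2 × Fin n)}
    (hA : ((grid n).induce A).Preconnected) (hA' : ((grid n).induce Aᶜ).Preconnected)
    {w : Fin 2 × Fin n} (hw : w ∈ A) {r : Fin 2} {c d : Fin n} (hcd : c ⋖ d) (hwc : w.2 ≤ c)
    (hc : (r, c) ∉ A) (hd : (r, d) ∈ A) {p : Fin 2 × Fin n} (hp : p ∉ A) : p.2 ≤ c := by
  by_contra! hcp
  obtain ⟨s, hsc, -⟩ := exists_mem_mem_of_covBy hA hw hd hcd hwc le_rfl
  obtain ⟨t, htc, htd⟩ := exists_mem_mem_of_covBy hA' hc hp hcd le_rfl (hcd.ge_of_gt hcp)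
  simp only [Set.mem_compl_iff] at htc htd
  obtain rfl | rfl : t = r ∨ t = s := by grind
  · exact htd hd
  · exact htc hsc

theorem exists_forall_mem_iff_lt {s : Set (Fin n)} (hs : IsLowerSet s) :
    ∃ a ≤ n, ∀ i, i ∈ s ↔ (i : ℕ) < a := by
  obtain rfl | ⟨m, rfl⟩ := hs.eq_univ_or_Iio
  · exact ⟨n, le_rfl, fun i => iff_of_true (Set.mem_univ i) i.2⟩
  · exact ⟨m, m.2.le, fun i => Iff.rfl⟩

theorem exists_eq_region {A : Set (Fin 2 × Fin n)}
    (hA : ∀ r c d, c ⋖ d → (r, d) ∈ A → (r, c) ∈ A) : ∃ a ≤ n, ∃ b ≤ n, A = region n a b := by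
  have hlower (r : Fin 2) : IsLowerSet {i | (r, i) ∈ A} :=
    isLowerSet_setOfPred.2 (antitone_iff_forall_covBy _ |>.2 (hA r))
  obtain ⟨a, ha, hAa⟩ := exists_forall_mem_iff_lt (hlower 0)
  obtain ⟨b, hb, hAb⟩ := exists_forall_mem_iff_lt (hlower 1)
  refine ⟨a, ha, b, hb, ?_⟩
  ext ⟨r, i⟩
  rw [mem_region]
  match r with
  | 0 => exact hAa i
  | 1 => exact hAb i

theorem exists_eq_region_of_first_of_last {A : Set (Fin 2 × Fin n)}
    (hA : ((grid n).induce A).Preconnected) (hA' : ((grid n).induce Aᶜ).Preconnected)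
    {p q : Fin 2 × Fin n} (hp : p ∈ A) (hq : q ∉ A) (hfirst : ∀ i, p.2 ≤ i)
    (hlast : ∀ i, i ≤ q.2) : ∃ a ≤ n, ∃ b ≤ n, A = region n a b := by
  refine exists_eq_region fun r c d hcd hd => ?_
  by_contra hc
  exact hcd.lt.not_ge
    ((hlast d).trans (le_of_notMem_of_covBy hA hA' hp hcd (hfirst c) hc hd hq))

theorem ncard_region (ha : a ≤ n) (hb : b ≤ n) : (region n a b).ncard = a + b := by
  have hunion : region n a b =
      {0} ×ˢ {i : Fin n | (i : ℕ) < a} ∪ {1} ×ˢ {i : Fin n | (i : ℕ) < b} := by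
    ext ⟨r, i⟩
    simp only [mem_region, Set.mem_union, Set.mem_prod, Set.mem_singleton_iff, Set.mem_ofPred_eq]
    grind
  have hdisj : Disjoint (({0} : Set (Fin 2)) ×ˢ {i : Fin n | (i : ℕ) < a})
      ({1} ×ˢ {i : Fin n | (i : ℕ) < b}) :=
    Set.disjoint_prod.2 <| .inl <| Set.disjoint_singleton.2 zero_ne_one
  have hcard (m : ℕ) (hm : m ≤ n) : {i : Fin n | (i : ℕ) < m}.ncard = m := by
    rw [Set.ncard_eq_toFinset_card', Set.toFinset_ofPred, Fin.card_filter_val_lt, min_eq_right hm]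
  rw [hunion, Set.ncard_union_eq hdisj, Set.ncard_prod, Set.ncard_prod, Set.ncard_singleton,
    Set.ncard_singleton, hcard a ha, hcard b hb, one_mul, one_mul]

theorem le_and_le_of_region_subset {a' b' : ℕ} (ha : a ≤ n) (hb : b ≤ n)
    (h : region n a b ⊆ region n a' b') : a ≤ a' ∧ b ≤ b' := by
  constructor <;> by_contra! hlt
  · exact (lt_irrefl a' <| h (a := (0, ⟨a', by omega⟩)) hlt)
  · exact (lt_irrefl b' <| h (a := (1, ⟨b', by omega⟩)) hlt)

theorem region_inj {a' b' : ℕ} (ha : a ≤ n) (hb : b ≤ n) (ha' : a' ≤ n) (hb' : b' ≤ n) :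
    region n a b = region n a' b' ↔ a = a' ∧ b = b' := by
  refine ⟨fun h => ?_, fun ⟨h, h'⟩ => h ▸ h' ▸ rfl⟩
  have hle := le_and_le_of_region_subset ha hb h.le
  have hge := le_and_le_of_region_subset ha' hb' h.ge
  exact ⟨hle.1.antisymm hge.1, hle.2.antisymm hge.2⟩

theorem ncard_compl_lt_of_covBy {A : Set (Fin 2 × Fin n)}
    (hA : ((grid n).induce A).Preconnected) (hA' : ((grid n).induce Aᶜ).Preconnected)
    {w : Fin 2 × Fin n} (hw : w ∈ A) (hfirst : ∀ i, w.2 ≤ i) {r : Fin 2} {c d : Fin n}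
    (hcd : c ⋖ d) (hc : (r, c) ∉ A) (hd : (r, d) ∈ A) : Aᶜ.ncard < n := by
  have hle {p : Fin 2 × Fin n} (hp : p ∉ A) : p.2 ≤ c :=
    le_of_notMem_of_covBy hA hA' hw hcd (hfirst c) hc hd hp
  have hmeet (i : Fin n) (hi : i ≤ c) : ∃ s, (s, i) ∈ A := by
    have hlt : i < d := hi.trans_lt hcd.lt
    obtain ⟨j, hij, hjd⟩ := exists_covBy_le_of_lt hlt
    obtain ⟨s, hs, -⟩ := exists_mem_mem_of_covBy hA hw hd hij (hfirst i) hjd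
    exact ⟨s, hs⟩
  have hinj : Set.InjOn Prod.snd Aᶜ := by
    rintro ⟨s, i⟩ hs ⟨t, j⟩ ht rfl
    obtain ⟨u, hu⟩ := hmeet i (hle hs)
    by_contra hst
    obtain rfl | rfl : u = s ∨ u = t := by grind
    · exact hs hu
    · exact ht hu
  rw [← hinj.ncard_image]
  refine (Set.ncard_lt_card (α := Fin n) fun huniv => ?_).trans_eq (Nat.card_fin n)
  obtain ⟨p, hp, hpd⟩ := huniv.ge (Set.mem_univ d)
  exact (hle hp).not_gt (hpd ▸ hcd.lt)

theorem ncard_eq_ncard_compl_iff {A : Set (Fin 2 × Fin n)} :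
    A.ncard = Aᶜ.ncard ↔ A.ncard = n := by
  have hsum := Set.ncard_add_ncard_compl A
  rw [Nat.card_prod, Nat.card_fin, Nat.card_fin] at hsum
  omega

theorem exists_eq_region_of_balanced [NeZero n] {A : Set (Fin 2 × Fin n)}
    (hA : ((grid n).induce A).Preconnected) (hA' : ((grid n).induce Aᶜ).Preconnected)
    (h0 : (1, 0) ∈ A) (hcard : A.ncard = Aᶜ.ncard) : ∃ k < n, A = region n k (n - k) := by
  have hncard := ncard_eq_ncard_compl_iff.1 hcard
  have hstep : ∀ r c d, c ⋖ d → (r, d) ∈ A → (r, c) ∈ A := by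
    intro r c d hcd hd
    by_contra hc
    have := ncard_compl_lt_of_covBy hA hA' h0 Fin.zero_le hcd hc hd
    omega
  obtain ⟨a, ha, b, hb, rfl⟩ := exists_eq_region hstep
  rw [ncard_region ha hb] at hncard
  have hb0 : 0 < b := h0
  exact ⟨a, by omega, by rw [← hncard, Nat.add_sub_cancel_left]⟩

theorem treeCount_region (ha : 1 ≤ a) (hb : 1 ≤ b) (han : a ≤ n) (hbn : b ≤ n) :
    treeCount (grid n) (region n a b) = T (min a b) := by
  rcases le_total a b with h | h
  · rw [treeCount_region_of_le ha h hbn, min_eq_left h]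
  · rw [treeCount_region_comm, treeCount_region_of_le hb h han, min_eq_right h]

/-! ### The recursion for `T` -/

theorem T_zero : T 0 = 0 := by
  have hempty : spanningTrees (grid 0) = ∅ :=
    Set.eq_empty_of_forall_notMem fun H hH => hH.2.connected.nonempty.elim fun p => p.2.elim0
  rw [T, hempty, Set.ncard_empty]

theorem T_one : T 1 = 1 := by
  have hadj : ∀ x, (grid 1).Adj x (1, 0) → x = (0, 0) := by
    rintro ⟨r, i⟩ h
    rw [grid_adj] at h
    grind
  have hcompl : ({(1, 0)}ᶜ : Set (Fin 2 × Fin 1)) = {(0, 0)} := by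
    ext ⟨r, i⟩
    simp only [Set.mem_compl_iff, Set.mem_singleton_iff, Prod.mk.injEq]
    grind
  have hrung : (grid 1).Adj (0, 0) (1, 0) := grid_adj.2 (.inl ⟨zero_ne_one, rfl⟩)
  rw [T, ncard_spanningTrees_of_pendant hrung hadj, hcompl, treeCount_singleton]

theorem compl_singleton_one_last :
    ({(1, Fin.last n)}ᶜ : Set (Fin 2 × Fin (n + 1))) = region (n + 1) (n + 1) n := by
  ext ⟨r, i⟩
  simp only [Set.mem_compl_iff, Set.mem_singleton_iff, Prod.mk.injEq, mem_region, Fin.ext_iff,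
    Fin.val_last]
  grind

theorem ncard_spanningTrees_deleteEdges_last_rung (n : ℕ) :
    (spanningTrees ((grid (n + 2)).deleteEdges {s((0, .last (n + 1)), (1, .last (n + 1)))})).ncard =
      T (n + 1) := by
  set G := (grid (n + 2)).deleteEdges {s((0, .last (n + 1)), (1, .last (n + 1)))} with hG
  have hadj : G.Adj (1, (Fin.last n).castSucc) (1, .last (n + 1)) := by
    simp only [hG, deleteEdges_adj, grid_adj, Set.mem_singleton_iff, Sym2.eq_iff, Prod.mk.injEq,
      Fin.ext_iff, Fin.val_castSucc, Fin.val_last]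
    grind
  have hpendant (x) (hx : G.Adj x (1, .last (n + 1))) : x = (1, (Fin.last n).castSucc) := by
    simp only [hG, deleteEdges_adj, grid_adj, Set.mem_singleton_iff, Sym2.eq_iff] at hx
    simp only [Prod.ext_iff, Fin.ext_iff, Fin.val_castSucc, Fin.val_last] at hx ⊢
    grind
  rw [ncard_spanningTrees_of_pendant hadj hpendant,
    treeCount_deleteEdges_singleton (not_and_of_not_right _ (not_not_intro rfl)),
    compl_singleton_one_last, treeCount_region (by omega) (by omega) le_rfl (by omega),
    min_eq_right (by omega)]

theorem eq_region_or_eq_compl_region {A : Set (Fin 2 × Fin (n + 1))}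
    (hA : splitCount (grid (n + 1)) A ≠ 0) (hu : (0, Fin.last n) ∈ A) (hv : (1, Fin.last n) ∉ A) :
    (∃ b < n + 1, region (n + 1) (n + 1) b = A) ∨
      ∃ a < n, (region (n + 1) (a + 1) (n + 1))ᶜ = A := by
  obtain ⟨hconn, hconn'⟩ := preconnected_of_splitCount_ne_zero hA
  by_cases hfirst : ∃ r, (r, 0) ∈ A
  · obtain ⟨r, hr⟩ := hfirst
    obtain ⟨a, ha, b, _, rfl⟩ :=
      exists_eq_region_of_first_of_last hconn hconn' hr hv Fin.zero_le Fin.le_last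
    have hna : n < a := hu
    have hbn : ¬ n < b := hv
    obtain rfl : a = n + 1 := by omega
    exact .inl ⟨b, by omega, rfl⟩
  · push Not at hfirst
    obtain ⟨a, _, b, hb, hab⟩ := exists_eq_region_of_first_of_last hconn'
      (by rwa [compl_compl]) (hfirst 0) (not_not_intro hu) Fin.zero_le Fin.le_last
    obtain rfl := compl_eq_comm.1 hab
    have ha0 : 0 < a := not_not.1 (hfirst 0)
    have hna : ¬ n < a := hu
    have hnb : n < b := not_not.1 hv
    obtain rfl : b = n + 1 := by omega
    exact .inr ⟨a - 1, by omega, by rw [Nat.sub_add_cancel ha0]⟩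

theorem finsum_mem_splitCount_last_rung (n : ℕ) :
    ∑ᶠ A ∈ {A | (0, Fin.last n) ∈ A ∧ (1, Fin.last n) ∉ A}, splitCount (grid (n + 1)) A =
      ∑ b ∈ Finset.range (n + 1), splitCount (grid (n + 1)) (region (n + 1) (n + 1) b) +
        ∑ a ∈ Finset.range n, splitCount (grid (n + 1)) (region (n + 1) (a + 1) (n + 1))ᶜ := by
  have hinj : Set.InjOn (fun b => region (n + 1) (n + 1) b) (Finset.range (n + 1)) := by
    intro b hb b' hb' h
    rw [Finset.mem_coe, Finset.mem_range] at hb hb'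
    exact (region_inj le_rfl hb.le le_rfl hb'.le |>.1 h).2
  have hinj' : Set.InjOn (fun a => (region (n + 1) (a + 1) (n + 1))ᶜ) (Finset.range n) := by
    intro a ha a' ha' h
    rw [Finset.mem_coe, Finset.mem_range] at ha ha'
    exact Nat.succ_injective
      (region_inj (by omega) le_rfl (by omega) le_rfl |>.1 (compl_injective h)).1
  have hdisj : Disjoint ((fun b => region (n + 1) (n + 1) b) '' Finset.range (n + 1))
      ((fun a => (region (n + 1) (a + 1) (n + 1))ᶜ) '' Finset.range n) := by
    rw [Set.disjoint_left]
    rintro _ ⟨b, -, rfl⟩ ⟨a, -, h⟩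
    have h0 : ((0, 0) : Fin 2 × Fin (n + 1)) ∈ region (n + 1) (n + 1) b := Nat.succ_pos n
    exact (Set.ext_iff.1 h (0, 0)).2 h0 (Nat.succ_pos a)
  have hmem (A) (hA : splitCount (grid (n + 1)) A ≠ 0) :
      A ∈ {A | (0, Fin.last n) ∈ A ∧ (1, Fin.last n) ∉ A} ↔
      A ∈ (fun b => region (n + 1) (n + 1) b) '' Finset.range (n + 1) ∪
        (fun a => (region (n + 1) (a + 1) (n + 1))ᶜ) '' Finset.range n := by
    simp only [Set.mem_union, Set.mem_image, Finset.mem_coe, Finset.mem_range, Set.mem_ofPred_eq]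
    refine ⟨fun h => eq_region_or_eq_compl_region hA h.1 h.2, ?_⟩
    rintro (⟨b, hb, rfl⟩ | ⟨a, ha, rfl⟩) <;>
      simp only [Set.mem_compl_iff, mem_region, Fin.val_last] <;> grind
  rw [finsum_mem_inter_support_eq' _ _ _ hmem, finsum_mem_union hdisj (Set.toFinite _)
    (Set.toFinite _), finsum_mem_image hinj, finsum_mem_image hinj', finsum_mem_coe_finset,
    finsum_mem_coe_finset]

theorem splitCount_region_zero (hn : 1 ≤ n) : splitCount (grid n) (region n 0 n) = 1 := by
  rw [splitCount, treeCount_compl_region, treeCount_region_comm (a := n - 0), Nat.sub_self,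
    Nat.sub_zero, treeCount_region_zero hn le_rfl, mul_one]

theorem splitCount_region_full (ha : 1 ≤ a) (han : a < n) :
    splitCount (grid n) (region n a n) = T a := by
  rw [splitCount, treeCount_compl_region, treeCount_region_comm (a := n - a), Nat.sub_self,
    treeCount_region_zero (by omega) (by omega), mul_one, treeCount_region_of_le ha han.le le_rfl]

theorem T_add_two_eq_sum (n : ℕ) :
    T (n + 2) = T (n + 1) + (1 + 2 * ∑ b ∈ Finset.range (n + 1), T (b + 1)) := by
  have hrung : (grid (n + 2)).Adj (0, .last (n + 1)) (1, .last (n + 1)) :=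
    grid_adj.2 (.inl ⟨zero_ne_one, rfl⟩)
  have hsplit (b) (hb : b ∈ Finset.range (n + 1)) :
      splitCount (grid (n + 2)) (region (n + 2) (b + 1) (n + 2)) = T (b + 1) :=
    splitCount_region_full (by omega) (by grind)
  rw [T, ncard_spanningTrees_eq_deleteEdges_add hrung, ncard_spanningTrees_deleteEdges_last_rung,
    finsum_mem_splitCount_last_rung]
  simp only [splitCount_compl, splitCount_region_comm (a := n + 1 + 1)]
  rw [Finset.sum_range_succ', splitCount_region_zero (by omega), Finset.sum_congr rfl hsplit]
  ring

theorem T_add_two (n : ℕ) : T (n + 2) + T n = 4 * T (n + 1) := by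
  cases n with
  | zero => simp [T_add_two_eq_sum, T_zero, T_one]
  | succ n =>
    have h := T_add_two_eq_sum n
    have h' : T (n + 3) = T (n + 2) +
        (1 + 2 * (∑ b ∈ Finset.range (n + 1), T (b + 1) + T (n + 2))) := by
      rw [T_add_two_eq_sum, Finset.sum_range_succ]
    change T (n + 3) + T (n + 1) = 4 * T (n + 2)
    omega

/-! ### The exact formula for `S` -/

/-- The darts of the `2`-by-`n` grid from row `1` to row `0` in the columns `a ≤ i < b`. -/
def rungs (n a b : ℕ) : Set ((Fin 2 × Fin n) × (Fin 2 × Fin n)) :=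
  (fun i => ((1, i), (0, i))) '' {i | a ≤ (i : ℕ) ∧ (i : ℕ) < b}

theorem mk_mem_rungs {r s : Fin 2} {i j : Fin n} :
    ((r, i), (s, j)) ∈ rungs n a b ↔ r = 1 ∧ s = 0 ∧ i = j ∧ a ≤ (i : ℕ) ∧ (i : ℕ) < b := by
  simp only [rungs, Set.mem_image, Set.mem_ofPred_eq, Prod.mk.injEq]
  grind

theorem ncard_rungs (hbn : b ≤ n) : (rungs n a b).ncard = b - a := by
  have hIco : Fin.val '' {i : Fin n | a ≤ (i : ℕ) ∧ (i : ℕ) < b} = Set.Ico a b := by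
    ext i
    refine ⟨?_, fun hi => ⟨⟨i, hi.2.trans_le hbn⟩, hi, rfl⟩⟩
    rintro ⟨i, hi, rfl⟩
    exact hi
  rw [rungs, Set.ncard_image_of_injective _ fun i j h => congrArg (·.1.2) h,
    ← Set.ncard_image_of_injective _ Fin.val_injective, hIco, Set.ncard_eq_toFinset_card',
    Set.toFinset_Ico, Nat.card_Ico]

theorem boundary_region_zero (n : ℕ) : boundary (grid n) (region n 0 n) = rungs n 0 n := by
  ext ⟨⟨r, i⟩, ⟨s, j⟩⟩
  simp only [boundary, Set.mem_ofPred_eq, mem_region, grid_adj, mk_mem_rungs]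
  grind

theorem boundary_region (ha : 1 ≤ a) (hab : a ≤ b) (hbn : b < n) :
    boundary (grid n) (region n a b) =
      insert ((0, ⟨a - 1, by omega⟩), (0, ⟨a, by omega⟩))
        (insert ((1, ⟨b - 1, by omega⟩), (1, ⟨b, hbn⟩)) (rungs n a b)) := by
  ext ⟨⟨r, i⟩, ⟨s, j⟩⟩
  simp only [boundary, Set.mem_ofPred_eq, mem_region, grid_adj, mk_mem_rungs, Set.mem_insert_iff,
    Prod.mk.injEq, Fin.ext_iff]
  grind

theorem ncard_boundary_region_of_le (ha : 1 ≤ a) (hab : a ≤ b) (hbn : b < n) :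
    (boundary (grid n) (region n a b)).ncard = b - a + 2 := by
  rw [boundary_region ha hab hbn, Set.ncard_insert_of_notMem, Set.ncard_insert_of_notMem,
    ncard_rungs hbn.le]
  · simp only [mk_mem_rungs]
    grind
  · simp only [mk_mem_rungs, Set.mem_insert_iff, Prod.mk.injEq]
    grind

theorem ncard_boundary_region (ha : 1 ≤ a) (hb : 1 ≤ b) (han : a < n) (hbn : b < n) :
    (boundary (grid n) (region n a b)).ncard = max a b - min a b + 2 := by
  rcases le_total a b with h | h
  · rw [ncard_boundary_region_of_le ha h hbn, max_eq_right h, min_eq_left h]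
  · rw [← rowFlip_preimage_region, ncard_boundary_preimage, ncard_boundary_region_of_le hb h han,
      max_eq_left h, min_eq_right h]

theorem splitCount_region_sub (ha : 1 ≤ a) (han : a < n) :
    splitCount (grid n) (region n a (n - a)) = T (min a (n - a)) ^ 2 := by
  rw [splitCount, treeCount_compl_region, Nat.sub_sub_self han.le,
    treeCount_region_comm (a := n - a),
    treeCount_region ha (by omega) han.le (Nat.sub_le _ _), sq]

theorem finsum_mem_ncard_boundary_mul_splitCount (n : ℕ) :
    ∑ᶠ A ∈ {A | (1, (0 : Fin (n + 1))) ∈ A ∧ A.ncard = Aᶜ.ncard},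
      (boundary (grid (n + 1)) A).ncard * splitCount (grid (n + 1)) A =
    ∑ k ∈ Finset.range (n + 1), (boundary (grid (n + 1)) (region (n + 1) k (n + 1 - k))).ncard *
      splitCount (grid (n + 1)) (region (n + 1) k (n + 1 - k)) := by
  have hinj : Set.InjOn (fun k => region (n + 1) k (n + 1 - k)) (Finset.range (n + 1)) := by
    intro k hk l hl h
    rw [Finset.mem_coe, Finset.mem_range] at hk hl
    exact (region_inj hk.le (Nat.sub_le _ _) hl.le (Nat.sub_le _ _) |>.1 h).1
  have hmem (A) (hA : (boundary (grid (n + 1)) A).ncard * splitCount (grid (n + 1)) A ≠ 0) :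
      A ∈ {A | (1, (0 : Fin (n + 1))) ∈ A ∧ A.ncard = Aᶜ.ncard} ↔
        A ∈ (fun k => region (n + 1) k (n + 1 - k)) '' Finset.range (n + 1) := by
    obtain ⟨hconn, hconn'⟩ := preconnected_of_splitCount_ne_zero (right_ne_zero_of_mul hA)
    simp only [Set.mem_image, Finset.mem_coe, Finset.mem_range]
    refine ⟨fun h => ?_, ?_⟩
    · obtain ⟨k, hk, rfl⟩ := exists_eq_region_of_balanced hconn hconn' h.1 h.2
      exact ⟨k, hk, rfl⟩
    · rintro ⟨k, hk, rfl⟩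
      refine ⟨Nat.sub_pos_of_lt hk, ?_⟩
      rw [ncard_eq_ncard_compl_iff, ncard_region hk.le (Nat.sub_le _ _)]
      omega
  rw [finsum_mem_inter_support_eq' _ _ _ hmem, finsum_mem_image hinj, finsum_mem_coe_finset]

theorem S_succ (n : ℕ) : S (n + 1) = n + 1 + ∑ k ∈ Finset.range n,
    (max (k + 1) (n - k) - min (k + 1) (n - k) + 2) * T (min (k + 1) (n - k)) ^ 2 := by
  have hterm (k) (hk : k ∈ Finset.range n) :
      (boundary (grid (n + 1)) (region (n + 1) (k + 1) (n + 1 - (k + 1)))).ncard *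
        splitCount (grid (n + 1)) (region (n + 1) (k + 1) (n + 1 - (k + 1))) =
      (max (k + 1) (n - k) - min (k + 1) (n - k) + 2) * T (min (k + 1) (n - k)) ^ 2 := by
    rw [Finset.mem_range] at hk
    rw [ncard_boundary_region (by omega) (by omega) (by omega) (by omega),
      splitCount_region_sub (by omega) (by omega), Nat.add_sub_add_right]
  rw [S, ncard_balancedSpanningTrees _ (1, 0), finsum_mem_ncard_boundary_mul_splitCount,
    Finset.sum_range_succ', Nat.sub_zero, boundary_region_zero, ncard_rungs le_rfl,
    splitCount_region_zero (by omega), Finset.sum_congr rfl hterm, Nat.sub_zero, mul_one, add_comm]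

end Grid

/-! ### Closed forms -/

theorem sum_range_of_reflect {M : Type*} [AddCommMonoid M] {m c : ℕ} {f : ℕ → M}
    (hf : ∀ k < m, f (m + c + m - 1 - k) = f k) : ∑ k ∈ Finset.range (m + c + m), f k =
      ∑ k ∈ Finset.range c, f (m + k) + 2 • ∑ k ∈ Finset.range m, f k := by
  have hreflect : ∑ k ∈ Finset.range m, f (m + c + k) = ∑ k ∈ Finset.range m, f k := by
    rw [← Finset.sum_range_reflect]
    refine Finset.sum_congr rfl fun k hk => ?_
    rw [Finset.mem_range] at hk
    rw [← hf k hk]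
    congr 1
    omega
  rw [Finset.sum_range_add, Finset.sum_range_add, hreflect, two_nsmul]
  abel

theorem S_add_add_one (m c : ℕ) : S (m + c + m + 1) = m + c + m + 1 +
    (∑ k ∈ Finset.range c, (max (m + k + 1) (m + c - k) - min (m + k + 1) (m + c - k) + 2) *
      T (min (m + k + 1) (m + c - k)) ^ 2 +
    2 * ∑ k ∈ Finset.range m, (2 * (m - 1 - k) + c + 3) * T (k + 1) ^ 2) := by
  rw [S_succ, sum_range_of_reflect fun k hk => ?_, smul_eq_mul]
  · congr 2
    · refine Finset.sum_congr rfl fun k _ => ?_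
      rw [show m + c + m - (m + k) = m + c - k by omega]
    · congr 1
      refine Finset.sum_congr rfl fun k hk => ?_
      rw [Finset.mem_range] at hk
      rw [min_eq_left (by omega), max_eq_right (by omega)]
      congr 1
      omega
  · rw [show m + c + m - 1 - k + 1 = m + c + m - k by omega,
      show m + c + m - (m + c + m - 1 - k) = k + 1 by omega, max_comm, min_comm]

theorem sq_sqrt_three : √3 ^ 2 = (3 : ℝ) :=
  Real.sq_sqrt zero_le_three

theorem T_closed_form (n : ℕ) :
    (T n : ℝ) = ((2 + √3) ^ n - (2 - √3) ^ n) / (2 * √3) := by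
  induction n using Nat.twoStepInduction with
  | zero => simp [T_zero]
  | one =>
    rw [T_one]
    field_simp
    push_cast
    ring
  | more n ih ih' =>
    have hrec := congrArg (Nat.cast (R := ℝ)) (T_add_two n)
    push_cast at hrec
    rw [eq_sub_of_add_eq hrec, ih, ih']
    field_simp
    linear_combination ((2 - √3) ^ n - (2 + √3) ^ n) * sq_sqrt_three

theorem inv_two_add_sqrt_three : (2 + √3)⁻¹ = (2 - √3 : ℝ) :=
  inv_eq_of_mul_eq_one_right (by linear_combination -sq_sqrt_three)

theorem T_succ_sq (m : ℕ) : T (m + 1) ^ 2 = T m ^ 2 + T (2 * m + 1) := by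
  suffices h : (T (m + 1) : ℝ) ^ 2 = T m ^ 2 + T (2 * m + 1) by exact_mod_cast h
  rw [T_closed_form, T_closed_form, T_closed_form]
  simp only [pow_succ, pow_mul', pow_zero, one_mul]
  generalize (2 + √3) ^ m = x
  generalize (2 - √3) ^ m = y
  field_simp
  linear_combination -(x - y) ^ 2 * sq_sqrt_three

theorem twelve_mul_T_succ_sq (m : ℕ) :
    12 * T (m + 1) ^ 2 + T (2 * m + 1) + 2 = T (2 * m + 3) := by
  have hconj : (2 + √3) ^ m * (2 - √3) ^ m = (1 : ℝ) := by
    rw [← inv_two_add_sqrt_three, ← mul_pow, mul_inv_cancel₀ (by positivity), one_pow]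
  suffices h : 12 * (T (m + 1) : ℝ) ^ 2 + T (2 * m + 1) + 2 = T (2 * m + 3) by exact_mod_cast h
  rw [T_closed_form, T_closed_form, T_closed_form]
  simp only [pow_succ, pow_mul', pow_zero, one_mul]
  generalize (2 + √3) ^ m = x at *
  generalize (2 - √3) ^ m = y at *
  field_simp
  linear_combination (24 * x * y + 8 - (2 * √3 ^ 2 + 12 * √3 + 16) * x ^ 2 -
    (2 * √3 ^ 2 - 12 * √3 + 16) * y ^ 2) * sq_sqrt_three - 24 * hconj

theorem sum_T_sq (m : ℕ) :
    12 * ∑ k ∈ Finset.range m, T (k + 1) ^ 2 + (2 * m + 1) = T (2 * m + 1) := by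
  induction m with
  | zero => simp [T_one]
  | succ m ih =>
    rw [Finset.sum_range_succ, show 2 * (m + 1) + 1 = 2 * m + 3 by ring, ← twelve_mul_T_succ_sq,
      ← ih]
    ring

theorem sum_mul_T_sq (m : ℕ) :
    12 * ∑ k ∈ Finset.range m, (m - 1 - k) * T (k + 1) ^ 2 + m ^ 2 = T m ^ 2 := by
  induction m with
  | zero => simp [T_zero]
  | succ m ih =>
    have hstep : ∑ k ∈ Finset.range (m + 1), (m + 1 - 1 - k) * T (k + 1) ^ 2 =
        ∑ k ∈ Finset.range m, (m - 1 - k) * T (k + 1) ^ 2 +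
          ∑ k ∈ Finset.range m, T (k + 1) ^ 2 := by
      rw [Finset.sum_range_succ, ← Finset.sum_add_distrib]
      simp only [add_tsub_cancel_right, tsub_self, zero_mul, add_zero]
      refine Finset.sum_congr rfl fun k hk => ?_
      rw [Finset.mem_range] at hk
      rw [show m - k = m - 1 - k + 1 by omega]
      ring
    rw [hstep, T_succ_sq, ← ih, ← sum_T_sq]
    ring

theorem two_mul_sum_T_sq (m c : ℕ) :
    ((2 * ∑ k ∈ Finset.range m, (2 * (m - 1 - k) + c + 3) * T (k + 1) ^ 2 : ℕ) : ℝ) =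
      (T m ^ 2 - m ^ 2) / 3 + (c + 3) / 6 * (T (2 * m + 1) - (2 * m + 1)) := by
  have hsplit : ∑ k ∈ Finset.range m, (2 * (m - 1 - k) + c + 3) * T (k + 1) ^ 2 =
      2 * ∑ k ∈ Finset.range m, (m - 1 - k) * T (k + 1) ^ 2 +
        (c + 3) * ∑ k ∈ Finset.range m, T (k + 1) ^ 2 := by
    rw [Finset.mul_sum, Finset.mul_sum, ← Finset.sum_add_distrib]
    exact Finset.sum_congr rfl fun k _ => by ring
  have hsum := congrArg (Nat.cast (R := ℝ)) (sum_T_sq m)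
  have hsum' := congrArg (Nat.cast (R := ℝ)) (sum_mul_T_sq m)
  rw [hsplit]
  push_cast [-Nat.cast_sum] at hsum hsum' ⊢
  linear_combination (c + 3) / 6 * hsum + hsum' / 3

theorem S_odd (m : ℕ) : (S (2 * m + 1) : ℝ) = T (2 * m + 1) / 2 + T m ^ 2 / 3 +
    (-1 / 12 * ((2 * m + 1 : ℕ) : ℝ) ^ 2 + 2 / 3 * (2 * m + 1 : ℕ) - 1 / 12) := by
  rw [show 2 * m + 1 = m + 0 + m + 1 by ring, S_add_add_one, Finset.range_zero, Finset.sum_empty,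
    zero_add, Nat.cast_add, two_mul_sum_T_sq m 0, show m + 0 + m + 1 = 2 * m + 1 by ring]
  push_cast
  ring

theorem S_even (m : ℕ) : (S (2 * (m + 1)) : ℝ) = 2 * T (m + 1) ^ 2 + T m ^ 2 / 3 +
    2 / 3 * T (2 * m + 1) +
    (-1 / 12 * ((2 * (m + 1) : ℕ) : ℝ) ^ 2 + 2 / 3 * (2 * (m + 1) : ℕ) + 1 / 3) := by
  rw [show 2 * (m + 1) = m + 1 + m + 1 by ring, S_add_add_one, Finset.sum_range_one, add_zero,
    Nat.sub_zero, max_self, min_self, Nat.sub_self, zero_add, Nat.cast_add (m + 1 + m + 1),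
    Nat.cast_add (2 * _), two_mul_sum_T_sq m 1]
  push_cast
  ring

/-! ### Limits -/

theorem T_lt_T_succ (n : ℕ) : T n < T (n + 1) := by
  induction n with
  | zero => simp only [T_zero, T_one, zero_add, zero_lt_one]
  | succ n ih =>
    have hrec : T (n + 1 + 1) + T n = 4 * T (n + 1) := T_add_two n
    omega

theorem T_ne_zero {n : ℕ} (hn : n ≠ 0) : (T n : ℝ) ≠ 0 :=
  Nat.cast_ne_zero.2 (Nat.succ_pred_eq_of_ne_zero hn ▸ (T_lt_T_succ _).ne_bot)

theorem tendsto_T_div_pow :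
    Tendsto (fun n : ℕ => (T n : ℝ) / (2 + √3) ^ n) atTop (𝓝 (1 / (2 * √3))) := by
  have hpos : 0 < √(3 : ℝ) := by positivity
  have hle : √(3 : ℝ) ≤ 2 := Real.sqrt_le_iff.2 (by norm_num)
  have hratio : Tendsto (fun n : ℕ => ((2 - √3) / (2 + √3)) ^ n) atTop (𝓝 0) :=
    tendsto_pow_atTop_nhds_zero_of_lt_one (div_nonneg (by linarith) (by linarith))
      ((div_lt_one (by linarith)).2 (by linarith))
  have hlim := (hratio.const_sub 1).div_const (2 * √3)
  rw [sub_zero] at hlim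
  refine hlim.congr fun n => ?_
  rw [T_closed_form, div_pow]
  field_simp

theorem tendsto_quadratic_div_T (a b c : ℝ) :
    Tendsto (fun n : ℕ => (a * (n : ℝ) ^ 2 + b * n + c) / T n) atTop (𝓝 0) := by
  have hpos : 0 < √(3 : ℝ) := by positivity
  have hpow (k : ℕ) : Tendsto (fun n : ℕ => (n : ℝ) ^ k / (2 + √3) ^ n) atTop (𝓝 0) :=
    tendsto_pow_const_div_const_pow_of_one_lt k (by linarith)
  have hlim := ((((hpow 2).const_mul a).add ((hpow 1).const_mul b)).add
    ((hpow 0).const_mul c)).div tendsto_T_div_pow (by positivity)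
  simp only [mul_zero, add_zero, zero_div] at hlim
  refine hlim.congr fun n => ?_
  simp only [Pi.div_apply]
  rw [← mul_div_assoc, ← mul_div_assoc, ← mul_div_assoc, ← add_div, ← add_div,
    div_div_div_cancel_right₀ (by positivity), pow_one, pow_zero, mul_one]

theorem tendsto_T_sq_div_T (c : ℕ) :
    Tendsto (fun m : ℕ => (T m : ℝ) ^ 2 / T (2 * m + c)) atTop
      (𝓝 ((2 - √3) ^ c / (2 * √3))) := by
  have hindex : Tendsto (fun m : ℕ => 2 * m + c) atTop atTop :=
    tendsto_atTop_mono (fun m => by grind) tendsto_id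
  have hlim := ((tendsto_T_div_pow.pow 2).div (tendsto_T_div_pow.comp hindex)
    (by positivity)).const_mul ((2 - √3) ^ c)
  have hvalue : (2 - √3) ^ c * ((1 / (2 * √3)) ^ 2 / (1 / (2 * √3))) =
      (2 - √3) ^ c / (2 * √3) := by
    field_simp
  rw [hvalue] at hlim
  refine hlim.congr' ?_
  filter_upwards [eventually_ne_atTop 0] with m hm
  have hT : (T (2 * m + c) : ℝ) ≠ 0 := T_ne_zero (by omega)
  simp only [Function.comp_apply, Pi.div_apply, ← inv_two_add_sqrt_three, inv_pow]
  field_simp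
  ring

theorem tendsto_T_div_T_succ :
    Tendsto (fun n : ℕ => (T n : ℝ) / T (n + 1)) atTop (𝓝 (2 - √3)) := by
  have hlim := (tendsto_T_div_pow.div (tendsto_T_div_pow.comp (tendsto_add_atTop_nat 1))
    (by positivity)).const_mul (2 - √3)
  rw [div_self (by positivity), mul_one] at hlim
  refine hlim.congr fun n => ?_
  have hT : (T (n + 1) : ℝ) ≠ 0 := T_ne_zero n.succ_ne_zero
  simp only [Function.comp_apply, Pi.div_apply, ← inv_two_add_sqrt_three]
  field_simp
  ring

theorem tendsto_S_div_T_odd :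
    Tendsto (fun m : ℕ => (S (2 * m + 1) : ℝ) / (T (2 * m + 1) : ℝ)) atTop
      (𝓝 ((3 + √3) / 9)) := by
  have hindex : Tendsto (fun m : ℕ => 2 * m + 1) atTop atTop :=
    tendsto_atTop_mono (fun m => by grind) tendsto_id
  have hlim := (((tendsto_T_sq_div_T 1).div_const 3).const_add (1 / 2)).add
    ((tendsto_quadratic_div_T (-1 / 12) (2 / 3) (-1 / 12)).comp hindex)
  have hvalue : 1 / 2 + (2 - √3) ^ 1 / (2 * √3) / 3 + 0 = (3 + √3) / 9 := by
    field_simp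
    linear_combination -6 * sq_sqrt_three
  rw [hvalue] at hlim
  refine hlim.congr fun m => ?_
  have hT : (T (2 * m + 1) : ℝ) ≠ 0 := T_ne_zero (by omega)
  rw [S_odd]
  simp only [Function.comp_apply]
  field_simp
  ring

theorem tendsto_S_div_T_even :
    Tendsto (fun m : ℕ => (S (2 * m) : ℝ) / (T (2 * m) : ℝ)) atTop
      (𝓝 ((1 + 4 * √3) / (6 * √3))) := by
  rw [← tendsto_add_atTop_iff_nat 1]
  have hindex : Tendsto (fun m : ℕ => 2 * (m + 1)) atTop atTop :=
    tendsto_atTop_mono (fun m => by grind) tendsto_id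
  have hindex' : Tendsto (fun m : ℕ => 2 * m + 1) atTop atTop :=
    tendsto_atTop_mono (fun m => by grind) tendsto_id
  have hlim := (((((tendsto_T_sq_div_T 0).comp (tendsto_add_atTop_nat 1)).const_mul 2).add
    ((tendsto_T_sq_div_T 2).div_const 3)).add
    ((tendsto_T_div_T_succ.comp hindex').const_mul (2 / 3))).add
    ((tendsto_quadratic_div_T (-1 / 12) (2 / 3) (1 / 3)).comp hindex)
  have hvalue : 2 * ((2 - √3) ^ 0 / (2 * √3)) + (2 - √3) ^ 2 / (2 * √3) / 3 +
      2 / 3 * (2 - √3) + 0 = (1 + 4 * √3) / (6 * √3) := by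
    field_simp
    linear_combination -18 * sq_sqrt_three
  rw [hvalue] at hlim
  refine hlim.congr fun m => ?_
  have hT : (T (2 * (m + 1)) : ℝ) ≠ 0 := T_ne_zero (by omega)
  rw [S_even]
  simp only [Function.comp_apply, add_zero]
  rw [show 2 * m + 2 = 2 * (m + 1) by ring]
  field_simp

end BalancedTrees

theorem theorem1 :
    (Filter.Tendsto
        (fun m : ℕ => (BalancedTrees.S (2 * m + 1) : ℝ) / (BalancedTrees.T (2 * m + 1) : ℝ))
        Filter.atTop (nhds ((3 + Real.sqrt 3) / 9)) ∧
      |(3 + Real.sqrt 3) / 9 - 0.53| < 0.005) ∧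
    (Filter.Tendsto
        (fun m : ℕ => (BalancedTrees.S (2 * m) : ℝ) / (BalancedTrees.T (2 * m) : ℝ))
        Filter.atTop (nhds ((1 + 4 * Real.sqrt 3) / (6 * Real.sqrt 3))) ∧
      |(1 + 4 * Real.sqrt 3) / (6 * Real.sqrt 3) - 0.76| < 0.005) := by
  have hlower : (1.73 : ℝ) < √3 := Real.lt_sqrt_of_sq_lt (by norm_num)
  have hupper : √3 < (1.74 : ℝ) := (Real.sqrt_lt' (by norm_num)).2 (by norm_num)
  refine ⟨⟨BalancedTrees.tendsto_S_div_T_odd, ?_⟩, BalancedTrees.tendsto_S_div_T_even, ?_⟩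
  · rw [abs_lt]
    constructor <;> linarith
  · rw [abs_sub_lt_iff, sub_lt_iff_lt_add, sub_lt_comm, div_lt_iff₀ (by positivity),
      lt_div_iff₀ (by positivity)]
    constructor <;> linarith
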